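/- Let $d$ be a natural number, let $(\mathcal F_t)_{t\ge 1}$ be a filtration on a probability space, and let $(x_t)_{t\ge 1}$ be a stochastic process with values in the closed Euclidean unit ball $\{x\in\mathbb R^d:\|x\|_2\le 1\}$ such that $x_t$ is $\mathcal F_t$-measurable for every $t\ge1$. Let $(\varepsilon_t)_{t\ge 2}$ be a martingale difference sequence, that is, for every $t\ge 1$, $\varepsilon_{t+1}$ is an $\mathcal F_{t+1}$-measurable integrable real random variable with $\mathbb E[\varepsilon_{t+1}\mid\mathcal F_t]=0$ almost surely. Assume that $|\varepsilon_{t+1}|\le 1$ almost surely for every $t\ge 1$, and let $\sigma_t^2=\mathbb E[\varepsilon_{t+1}^2\mid\mathcal F_t]$. Let $\lambda>0$ and, for $t\ge 1$, define $$H_t=\sum_{s=1}^{t-1}\sigma_s^2\,x_sx_s^{\mathsf T}+\lambda I_d,\qquad S_t=\sum_{s=1}^{t-1}\varepsilon_{s+1}x_s,$$ and write $\|v\|_{A}=\sqrt{v^{\mathsf T}Av}$. Then for every $\delta\in(0,1]$, $$\mathbb P\left(\exists\, t\ge 1:\ \|S_t\|_{H_t^{-1}}\ \ge\ \frac{\sqrt\lambda}{2}+\frac{2}{\sqrt\lambda}\log\left(\frac{\det(H_t)^{1/2}\lambda^{-d/2}}{\delta}\right)+\frac{2}{\sqrt\lambda}\,d\log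 2\right)\le\delta .$$ -/

import Mathlib

open MeasureTheory

/-- The weighted norm `‖v‖_A = √(vᵀ A v)`, for a positive semidefinite matrix `A`. -/
noncomputable def weightedNorm {d : ℕ} (A : Matrix (Fin d) (Fin d) ℝ)
    (v : EuclideanSpace ℝ (Fin d)) : ℝ :=
  √(v.ofLp ⬝ᵥ A.mulVec v.ofLp)

/-- `(ε_t)_{t ≥ 2}` is a martingale difference sequence for `(ℱ_t)_{t ≥ 1}`: for each `t ≥ 1`,
`ε_{t+1}` is `ℱ_{t+1}`-measurable, integrable, and `E[ε_{t+1} | ℱ_t] = 0` almost surely. -/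
structure IsMartingaleDifference {Ω : Type*} {mΩ : MeasurableSpace Ω} (ℱ : Filtration ℕ mΩ)
    (P : Measure Ω) (ε : ℕ → Ω → ℝ) : Prop where
  measurable : ∀ t, 1 ≤ t → Measurable[ℱ (t + 1)] (ε (t + 1))
  integrable : ∀ t, 1 ≤ t → Integrable (ε (t + 1)) P
  condExp_eq_zero : ∀ t, 1 ≤ t → P[ε (t + 1) | ℱ t] =ᵐ[P] 0

/-- The conditional second moment (conditional variance) `σ_t² = E[ε_{t+1}² | ℱ_t]`. -/
noncomputable def sigmaSq {Ω : Type*} {mΩ : MeasurableSpace Ω} (ℱ : Filtration ℕ mΩ)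
    (P : Measure Ω) (ε : ℕ → Ω → ℝ) (t : ℕ) : Ω → ℝ :=
  P[fun ω => ε (t + 1) ω ^ 2 | ℱ t]

/-- `S_t = ∑_{s=1}^{t-1} ε_{s+1} x_s`. -/
noncomputable def martingaleSum {Ω : Type*} {d : ℕ} (x : ℕ → Ω → EuclideanSpace ℝ (Fin d))
    (ε : ℕ → Ω → ℝ) (t : ℕ) (ω : Ω) : EuclideanSpace ℝ (Fin d) :=
  ∑ s ∈ Finset.Ico 1 t, ε (s + 1) ω • x s ω

/-- `H_t = ∑_{s=1}^{t-1} σ_s² x_s x_sᵀ + l I_d`. -/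
noncomputable def regularizedVariation {Ω : Type*} {mΩ : MeasurableSpace Ω} {d : ℕ}
    (ℱ : Filtration ℕ mΩ) (P : Measure Ω) (x : ℕ → Ω → EuclideanSpace ℝ (Fin d))
    (ε : ℕ → Ω → ℝ) (l : ℝ) (t : ℕ) (ω : Ω) : Matrix (Fin d) (Fin d) ℝ :=
  (∑ s ∈ Finset.Ico 1 t,
    sigmaSq ℱ P ε s ω • Matrix.vecMulVec (x s ω).ofLp (x s ω).ofLp)
    + l • (1 : Matrix (Fin d) (Fin d) ℝ)

/-! ### Change of variables and symmetrisation -/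

open scoped ENNReal

/-! The proof is the method of mixtures, with Lebesgue measure on the unit ball `B` as mixing
measure. For `‖v‖ ≤ 1`, the bounds `exp y ≤ 1 + y + y²` (for `|y| ≤ 1`) and `1 + z ≤ exp z` make
`exp (⟨v, S_t⟩ - ‖v‖²_{H_t})` a supermartingale (`setLIntegral_mul_exp_le`). By Tonelli its integral
`M_t` over `B` is one too, and `M_1 = N := ∫_B exp (-l‖v‖²)`. Ville's inequality then gives `M_t ≥ N
/ δ` for some `t` with probability at most `δ`. It remains to bound `M_t` below. Substitute `v ↦ a +
L v`, where `‖a‖ ≤ 1/2` makes the exponent large and `L` turns `H_t` into `(l/4) I`, so that `a + L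
B ⊆ B`. The terms linear in `v` disappear on averaging `v` with `-v`, and what is left is at least
`exp (√l/2 · ‖S_t‖_{H_t⁻¹} - l/4) · |det L| · N`. The factor `N` cancels without being computed;
`|det L| = 2⁻ᵈ l^{d/2} det(H_t)^{-1/2}` gives the logarithmic terms of the threshold. -/

theorem lintegral_eq_abs_det_mul_lintegral_affine {E : Type*} [NormedAddCommGroup E]
    [NormedSpace ℝ E] [MeasurableSpace E] [BorelSpace E] [FiniteDimensional ℝ E]
    (μ : Measure E) [μ.IsAddHaarMeasure] (L : E →ₗ[ℝ] E) (hL : LinearMap.det L ≠ 0) (a : E)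
    {F : E → ℝ≥0∞} (hF : Measurable F) :
    ∫⁻ x, F x ∂μ = ENNReal.ofReal |LinearMap.det L| * ∫⁻ x, F (a + L x) ∂μ := by
  have hLm : Measurable L := L.continuous_of_finiteDimensional.measurable
  have h1 : ∫⁻ x, F (a + L x) ∂μ = ∫⁻ y, F (a + y) ∂(μ.map L) := by
    exact (lintegral_map (hF.comp (measurable_const_add a)) hLm).symm
  rw [h1, Measure.map_linearMap_addHaar_eq_smul_addHaar μ hL, lintegral_smul_measure,
    lintegral_add_left_eq_self (μ := μ) F a, smul_eq_mul, ← mul_assoc,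
    ← ENNReal.ofReal_mul (abs_nonneg _), ← abs_mul, mul_inv_cancel₀ hL]
  simp

theorem lintegral_le_lintegral_of_symm {E : Type*} [NormedAddCommGroup E]
    [MeasurableSpace E] [BorelSpace E] (μ : Measure E)
    [μ.IsNegInvariant] {f g : E → ℝ≥0∞} (hg : Measurable g)
    (h : ∀ x, 2 * f x ≤ g x + g (-x)) : ∫⁻ x, f x ∂μ ≤ ∫⁻ x, g x ∂μ := by
  have h2 : ∫⁻ x, g (-x) ∂μ = ∫⁻ x, g x ∂μ := lintegral_neg_eq_self g
  have h3 : 2 * ∫⁻ x, f x ∂μ ≤ 2 * ∫⁻ x, g x ∂μ := by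
    rw [← lintegral_const_mul' _ _ (by simp)]
    calc ∫⁻ x, 2 * f x ∂μ ≤ ∫⁻ x, (g x + g (-x)) ∂μ := lintegral_mono h
      _ = 2 * ∫⁻ x, g x ∂μ := by rw [lintegral_add_left hg, h2, two_mul]
  exact (ENNReal.mul_le_mul_iff_right (by simp) (by simp)).1 h3

/-- This is `1 ≤ cosh a`: averaging over a sign discards the odd part `a` of an exponent. -/
theorem two_mul_exp_le_exp_add_exp_neg (a b : ℝ) :
    2 * Real.exp b ≤ Real.exp (a + b) + Real.exp (-a + b) := by
  rw [Real.exp_add, Real.exp_add]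
  have h := Real.one_le_cosh a
  rw [Real.cosh_eq] at h
  nlinarith [Real.exp_pos b]

/-! ### Quadratic forms and the lower bound for the mixture -/

section Quadratic

variable {d : ℕ}

theorem EuclideanSpace.dotProduct_ofLp_self (v : EuclideanSpace ℝ (Fin d)) :
    v.ofLp ⬝ᵥ v.ofLp = ‖v‖ ^ 2 := by
  rw [EuclideanSpace.real_norm_sq_eq]
  simp [dotProduct, sq]

open scoped MatrixOrder in
-- Factor `H = Bᵀ B` and take `T = √l B⁻¹`.
theorem Matrix.PosDef.exists_transpose_mul_mul_eq_smul_one {H : Matrix (Fin d) (Fin d) ℝ}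
    (hH : H.PosDef) {l : ℝ} (hl : 0 < l) :
    ∃ T : Matrix (Fin d) (Fin d) ℝ, T.transpose * H * T = l • (1 : Matrix (Fin d) (Fin d) ℝ) ∧
      |T.det| = l ^ ((d : ℝ) / 2) * H.det ^ (-(1 / 2) : ℝ) := by
  obtain ⟨B, hB⟩ := CStarAlgebra.nonneg_iff_eq_star_mul_self.1
    (Matrix.nonneg_iff_posSemidef.2 hH.posSemidef)
  have hBt : H = B.transpose * B := by
    rw [hB, Matrix.star_eq_conjTranspose, Matrix.conjTranspose_eq_transpose_of_trivial]
  have hdet : H.det = B.det ^ 2 := by rw [hBt, Matrix.det_mul, Matrix.det_transpose, sq]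
  have hpos := hH.det_pos
  have hB0 : B.det ≠ 0 := by
    intro h; rw [hdet, h] at hpos; simp at hpos
  have hBu : IsUnit B.det := isUnit_iff_ne_zero.2 hB0
  refine ⟨√l • B⁻¹, ?_, ?_⟩
  · rw [hBt, Matrix.transpose_smul, Matrix.smul_mul, Matrix.smul_mul, Matrix.mul_smul, smul_smul,
      Real.mul_self_sqrt hl.le, Matrix.transpose_nonsing_inv, ← Matrix.mul_assoc,
      Matrix.nonsing_inv_mul _ (by rwa [Matrix.det_transpose]), Matrix.one_mul,
      Matrix.mul_nonsing_inv _ hBu]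
  · rw [Matrix.det_smul, Matrix.det_nonsing_inv, Ring.inverse_eq_inv', abs_mul, abs_inv, hdet,
      Fintype.card_fin, abs_of_nonneg (by positivity), Real.rpow_neg (by positivity),
      ← Real.sqrt_eq_rpow, Real.sqrt_sq_eq_abs, Real.sqrt_eq_rpow, ← Real.rpow_natCast,
      ← Real.rpow_mul hl.le]
    congr 2; ring

theorem Matrix.PosSemidef.mul_sq_norm_le {H : Matrix (Fin d) (Fin d) ℝ} {l : ℝ}
    (hH : (H - l • (1 : Matrix (Fin d) (Fin d) ℝ)).PosSemidef) (v : EuclideanSpace ℝ (Fin d)) :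
    l * ‖v‖ ^ 2 ≤ v.ofLp ⬝ᵥ H.mulVec v.ofLp := by
  have h := hH.dotProduct_mulVec_nonneg v.ofLp
  rw [Matrix.sub_mulVec, Matrix.smul_mulVec, Matrix.one_mulVec, star_trivial, dotProduct_sub,
    dotProduct_smul, EuclideanSpace.dotProduct_ofLp_self] at h
  simpa using h

theorem Matrix.PosSemidef.posDef_of_sub_smul_one {H : Matrix (Fin d) (Fin d) ℝ} {l : ℝ}
    (hl : 0 < l) (hH : (H - l • (1 : Matrix (Fin d) (Fin d) ℝ)).PosSemidef) : H.PosDef := by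
  have h := (Matrix.PosDef.one (n := Fin d) (R := ℝ)).smul hl
  simpa using h.posSemidef_add hH

/-- A point of the ball of radius `1 / 2` at which the concave quadratic `⟨·, S⟩ - ‖·‖²_H` is
large. -/
theorem exists_norm_le_half_and_le_dotProduct_sub {H : Matrix (Fin d) (Fin d) ℝ} {l : ℝ}
    (hl : 0 < l) (hH : (H - l • (1 : Matrix (Fin d) (Fin d) ℝ)).PosSemidef)
    (S : EuclideanSpace ℝ (Fin d)) :
    ∃ v : EuclideanSpace ℝ (Fin d), ‖v‖ ≤ 1 / 2 ∧
      √l / 2 * weightedNorm H⁻¹ S - l / 4 ≤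
        v.ofLp ⬝ᵥ S.ofLp - v.ofLp ⬝ᵥ H.mulVec v.ofLp := by
  have hpd := hH.posDef_of_sub_smul_one hl
  set w := weightedNorm H⁻¹ S with hw
  have hsq : w ^ 2 = S.ofLp ⬝ᵥ H⁻¹.mulVec S.ofLp := by
    rw [hw, weightedNorm, Real.sq_sqrt]
    simpa using hpd.inv.posSemidef.dotProduct_mulVec_nonneg S.ofLp
  have hw0 : 0 ≤ w := Real.sqrt_nonneg _
  rcases hw0.eq_or_lt with h0 | hwpos
  · refine ⟨0, by simp, ?_⟩
    rw [← h0]; simp; positivity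
  set u : EuclideanSpace ℝ (Fin d) := WithLp.toLp 2 (H⁻¹.mulVec S.ofLp) with hu
  have hHu : H.mulVec u.ofLp = S.ofLp := by
    rw [hu, Matrix.mulVec_mulVec, Matrix.mul_nonsing_inv _ hpd.det_pos.ne'.isUnit,
      Matrix.one_mulVec]
  have huS : u.ofLp ⬝ᵥ S.ofLp = w ^ 2 := by rw [hsq, dotProduct_comm]
  have hun : l * ‖u‖ ^ 2 ≤ w ^ 2 := by
    have := hH.mul_sq_norm_le u
    rwa [hHu, huS] at this
  have hun' : √l * ‖u‖ ≤ w := by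
    refine le_of_pow_le_pow_left₀ two_ne_zero hw0 ?_
    rwa [mul_pow, Real.sq_sqrt hl.le]
  -- At `c • u` the quadratic equals `(c - c²) w²`; this `c` gives the stated value exactly, and `√l
  -- ‖u‖ ≤ w` keeps the norm at most `1/2`.
  refine ⟨(√l / (2 * w)) • u, ?_, ?_⟩
  · rw [norm_smul, Real.norm_of_nonneg (by positivity), div_mul_eq_mul_div,
      div_le_div_iff₀ (by positivity) (by positivity)]
    linarith
  · rw [WithLp.ofLp_smul, Matrix.mulVec_smul, hHu, smul_dotProduct, smul_dotProduct,
      dotProduct_smul, huS]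
    simp only [smul_eq_mul]
    have : l = √l ^ 2 := (Real.sq_sqrt hl.le).symm
    apply le_of_eq
    rw [show l / 4 = √l ^ 2 / 4 by rw [← this]]
    field_simp
    ring

theorem measurable_ofReal_exp_dotProduct_sub (H : Matrix (Fin d) (Fin d) ℝ)
    (S : EuclideanSpace ℝ (Fin d)) :
    Measurable fun v : EuclideanSpace ℝ (Fin d) =>
      ENNReal.ofReal (Real.exp (v.ofLp ⬝ᵥ S.ofLp - v.ofLp ⬝ᵥ H.mulVec v.ofLp)) := by
  apply Measurable.ennreal_ofReal
  apply Continuous.measurable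
  fun_prop

/-- Lower bound for the mixture of the exponentials `exp (⟨v, S⟩ - ‖v‖²_H)` over the unit ball. -/
theorem mul_lintegral_exp_neg_le_lintegral_exp_dotProduct_sub {H : Matrix (Fin d) (Fin d) ℝ}
    {l : ℝ} (hl : 0 < l) (hH : (H - l • (1 : Matrix (Fin d) (Fin d) ℝ)).PosSemidef)
    (S : EuclideanSpace ℝ (Fin d)) :
    ENNReal.ofReal (Real.exp (√l / 2 * weightedNorm H⁻¹ S - l / 4) *
        ((1 / 2) ^ d * (l ^ ((d : ℝ) / 2) * H.det ^ (-(1 / 2) : ℝ)))) *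
      ∫⁻ v in Metric.closedBall (0 : EuclideanSpace ℝ (Fin d)) 1,
        ENNReal.ofReal (Real.exp (-(l * ‖v‖ ^ 2))) ≤
    ∫⁻ v in Metric.closedBall (0 : EuclideanSpace ℝ (Fin d)) 1,
      ENNReal.ofReal (Real.exp (v.ofLp ⬝ᵥ S.ofLp - v.ofLp ⬝ᵥ H.mulVec v.ofLp)) := by
  have hpd := hH.posDef_of_sub_smul_one hl
  obtain ⟨T, hT, hTdet⟩ := hpd.exists_transpose_mul_mul_eq_smul_one hl
  obtain ⟨a, ha, hag⟩ := exists_norm_le_half_and_le_dotProduct_sub hl hH S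
  set m : ℝ := √l / 2 * weightedNorm H⁻¹ S - l / 4 with hm
  set B := Metric.closedBall (0 : EuclideanSpace ℝ (Fin d)) 1 with hB
  have hBm : MeasurableSet B := Metric.isClosed_closedBall.measurableSet
  -- The factor `1/2` sends the unit ball into the half ball, leaving room for the shift by `a`; it
  -- costs `2⁻ᵈ` in the determinant.
  set L : EuclideanSpace ℝ (Fin d) →ₗ[ℝ] EuclideanSpace ℝ (Fin d) :=
    Matrix.toLpLin 2 2 ((1 / 2 : ℝ) • T) with hLdef
  have hLof (v : EuclideanSpace ℝ (Fin d)) : (L v).ofLp = (1 / 2 : ℝ) • T.mulVec v.ofLp := by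
    rw [hLdef, Matrix.toLpLin_apply, Matrix.smul_mulVec]
  have hquad (v : EuclideanSpace ℝ (Fin d)) :
      (L v).ofLp ⬝ᵥ H.mulVec (L v).ofLp = l / 4 * ‖v‖ ^ 2 := by
    have h1 : T.mulVec v.ofLp ⬝ᵥ H.mulVec (T.mulVec v.ofLp) = l * ‖v‖ ^ 2 := by
      rw [← EuclideanSpace.dotProduct_ofLp_self, Matrix.mulVec_mulVec, dotProduct_comm,
        Matrix.dotProduct_mulVec, ← Matrix.mulVec_transpose, Matrix.mulVec_mulVec,
        dotProduct_comm, ← Matrix.mul_assoc, hT, Matrix.smul_mulVec, Matrix.one_mulVec,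
        dotProduct_smul, smul_eq_mul]
    rw [hLof, Matrix.mulVec_smul, smul_dotProduct, dotProduct_smul, h1]
    simp only [smul_eq_mul]; ring
  have hLdet : |LinearMap.det L| = (1 / 2) ^ d * (l ^ ((d : ℝ) / 2) * H.det ^ (-(1 / 2) : ℝ)) := by
    rw [hLdef, LinearMap.det_toLpLin, Matrix.det_smul, abs_mul, hTdet, Fintype.card_fin,
      abs_of_nonneg (by positivity)]
  have hLdet0 : LinearMap.det L ≠ 0 := by
    rw [← abs_pos, hLdet]
    have := Real.rpow_pos_of_pos hpd.det_pos (-(1 / 2))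
    positivity
  have hLnorm (v : EuclideanSpace ℝ (Fin d)) : ‖L v‖ ≤ ‖v‖ / 2 := by
    have h1 := hH.mul_sq_norm_le (L v)
    rw [hquad] at h1
    refine le_of_pow_le_pow_left₀ two_ne_zero (by positivity) ?_
    have : l * ‖L v‖ ^ 2 ≤ l * (‖v‖ / 2) ^ 2 := by linarith
    exact le_of_mul_le_mul_left this hl
  set F : EuclideanSpace ℝ (Fin d) → ℝ≥0∞ := fun v =>
    ENNReal.ofReal (Real.exp (v.ofLp ⬝ᵥ S.ofLp - v.ofLp ⬝ᵥ H.mulVec v.ofLp)) with hF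
  have hFm : Measurable F := measurable_ofReal_exp_dotProduct_sub H S
  rw [← lintegral_indicator hBm F,
    lintegral_eq_abs_det_mul_lintegral_affine volume L hLdet0 a (hFm.indicator hBm), hLdet,
    mul_comm (Real.exp m),
    ENNReal.ofReal_mul (by have := hpd.det_pos; positivity), mul_assoc]
  refine mul_le_mul_right ?_ _
  rw [← lintegral_const_mul' _ _ ENNReal.ofReal_ne_top, ← lintegral_indicator hBm]
  refine lintegral_le_lintegral_of_symm volume
    ((hFm.indicator hBm).comp ((measurable_const_add a).comp
      L.continuous_of_finiteDimensional.measurable)) fun v => ?_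
  by_cases hv : v ∈ B
  · have hv1 : ‖v‖ ≤ 1 := by simpa [hB] using hv
    have h1 : a + L v ∈ B := by
      have := norm_add_le a (L v)
      have := hLnorm v
      simp only [hB, mem_closedBall_zero_iff]; linarith
    have h2 : a + L (-v) ∈ B := by
      have := norm_add_le a (L (-v))
      have := hLnorm (-v)
      rw [norm_neg] at this
      simp only [hB, mem_closedBall_zero_iff]; linarith
    rw [Set.indicator_of_mem hv, Set.indicator_of_mem h1, Set.indicator_of_mem h2, hF]
    simp only
    rw [← ENNReal.ofReal_mul (Real.exp_pos _).le, ← Real.exp_add,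
      ← ENNReal.ofReal_add (Real.exp_pos _).le (Real.exp_pos _).le,
      two_mul, ← ENNReal.ofReal_add (Real.exp_pos _).le (Real.exp_pos _).le, ← two_mul]
    apply ENNReal.ofReal_le_ofReal
    -- The exponent at `a + L v` splits into a part `c` odd in `v` and a part `b` even in `v`.
    set c : ℝ := (L v).ofLp ⬝ᵥ S.ofLp - a.ofLp ⬝ᵥ H.mulVec (L v).ofLp
      - (L v).ofLp ⬝ᵥ H.mulVec a.ofLp
    set b : ℝ := a.ofLp ⬝ᵥ S.ofLp - a.ofLp ⬝ᵥ H.mulVec a.ofLp - l / 4 * ‖v‖ ^ 2 with hb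
    have e1 : (a + L v).ofLp ⬝ᵥ S.ofLp - (a + L v).ofLp ⬝ᵥ H.mulVec (a + L v).ofLp = c + b := by
      rw [hb, ← hquad]
      simp only [WithLp.ofLp_add, Matrix.mulVec_add, add_dotProduct, dotProduct_add, c]
      ring
    have e2 : (a + L (-v)).ofLp ⬝ᵥ S.ofLp - (a + L (-v)).ofLp ⬝ᵥ H.mulVec (a + L (-v)).ofLp
        = -c + b := by
      rw [hb, ← hquad]
      simp only [map_neg, WithLp.ofLp_neg, WithLp.ofLp_add, Matrix.mulVec_add, Matrix.mulVec_neg,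
        add_dotProduct, dotProduct_add, neg_dotProduct, dotProduct_neg, c]
      ring
    rw [e1, e2]
    refine le_trans ?_ (two_mul_exp_le_exp_add_exp_neg c b)
    have : m + -(l * ‖v‖ ^ 2) ≤ b := by
      have : 0 ≤ l * ‖v‖ ^ 2 := by positivity
      rw [hb]; linarith
    gcongr
  · simp [Set.indicator_of_notMem hv]

end Quadratic

/-! ### Ville's maximal inequality -/

/-- Ville's inequality for nonnegative supermartingales with values in `ℝ≥0∞`, the supermartingale
property being stated through integrals over the sets of the filtration. -/
theorem mul_measure_exists_le_le_lintegral {Ω : Type*} {mΩ : MeasurableSpace Ω} {P : Measure Ω}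
    {ℱ : Filtration ℕ mΩ} {M : ℕ → Ω → ℝ≥0∞} (hM : ∀ t, 1 ≤ t → Measurable[ℱ t] (M t))
    (hsuper : ∀ t, 1 ≤ t → ∀ A, MeasurableSet[ℱ t] A →
      ∫⁻ ω in A, M (t + 1) ω ∂P ≤ ∫⁻ ω in A, M t ω ∂P) (c : ℝ≥0∞) :
    c * P {ω | ∃ t, 1 ≤ t ∧ c ≤ M t ω} ≤ ∫⁻ ω, M 1 ω ∂P := by
  set E : ℕ → Set Ω := fun n => {ω | ∃ t, 1 ≤ t ∧ t ≤ n ∧ c ≤ M t ω} with hE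
  have hEm (n : ℕ) : MeasurableSet[ℱ n] (E n) := by
    have : E n = ⋃ t ∈ Finset.Icc 1 n, {ω | c ≤ M t ω} := by
      ext ω; simp [hE, and_assoc]
    rw [this]
    refine Finset.measurableSet_biUnion _ fun t ht => ?_
    rw [Finset.mem_Icc] at ht
    exact ℱ.mono ht.2 _ (measurableSet_le measurable_const (hM t ht.1))
  have hsucc (n : ℕ) : E (n + 1) = E n ∪ ((E n)ᶜ ∩ {ω | c ≤ M (n + 1) ω}) := by
    ext ω
    simp only [hE, Set.mem_union, Set.mem_ofPred_eq, Set.mem_inter_iff, Set.mem_compl_iff]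
    constructor
    · rintro ⟨t, h1, h2, h3⟩
      by_cases h : ∃ t, 1 ≤ t ∧ t ≤ n ∧ c ≤ M t ω
      · exact Or.inl h
      · rcases Nat.le_succ_iff.1 h2 with h4 | h4
        · exact absurd ⟨t, h1, h4, h3⟩ h
        · subst h4
          exact Or.inr ⟨h, h3⟩
    · rintro (⟨t, h1, h2, h3⟩ | ⟨-, h⟩)
      · exact ⟨t, h1, by omega, h3⟩
      · exact ⟨n + 1, by omega, le_rfl, h⟩
  -- The left side is the mean of the process frozen at level `c` once it has crossed; it does not
  -- increase with `n`.
  have key (n : ℕ) : c * P (E (n + 1)) + ∫⁻ ω in (E (n + 1))ᶜ, M (n + 1) ω ∂P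
      ≤ ∫⁻ ω, M 1 ω ∂P := by
    have hstep (k : ℕ) : c * P (E (k + 1)) + ∫⁻ ω in (E (k + 1))ᶜ, M (k + 1) ω ∂P
        ≤ c * P (E k) + ∫⁻ ω in (E k)ᶜ, M (k + 1) ω ∂P := by
      set G : Set Ω := {ω | c ≤ M (k + 1) ω}
      have hG : MeasurableSet G :=
        ℱ.le (k + 1) _ (measurableSet_le measurable_const (hM (k + 1) (by omega)))
      have hEk : MeasurableSet (E k) := ℱ.le k _ (hEm k)
      have h1 : P (E (k + 1)) ≤ P (E k) + P ((E k)ᶜ ∩ G) := by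
        rw [hsucc]; exact measure_union_le _ _
      have h2 : (E (k + 1))ᶜ = (E k)ᶜ \ G := by
        rw [hsucc]; ext ω
        simp only [Set.mem_compl_iff, Set.mem_union, Set.mem_inter_iff, Set.mem_sdiff]
        tauto
      have h3 : c * P ((E k)ᶜ ∩ G) ≤ ∫⁻ ω in (E k)ᶜ ∩ G, M (k + 1) ω ∂P := by
        rw [← setLIntegral_const]
        exact setLIntegral_mono' (hEk.compl.inter hG) fun ω hω => hω.2
      calc c * P (E (k + 1)) + ∫⁻ ω in (E (k + 1))ᶜ, M (k + 1) ω ∂P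
          ≤ c * (P (E k) + P ((E k)ᶜ ∩ G)) + ∫⁻ ω in (E k)ᶜ \ G, M (k + 1) ω ∂P := by
            rw [h2]; gcongr
        _ ≤ c * P (E k) + (∫⁻ ω in (E k)ᶜ ∩ G, M (k + 1) ω ∂P
              + ∫⁻ ω in (E k)ᶜ \ G, M (k + 1) ω ∂P) := by
            rw [mul_add, add_assoc]; gcongr
        _ = _ := by rw [lintegral_inter_add_sdiff _ _ hG]
    induction n with
    | zero =>
      refine (hstep 0).trans ?_
      have : E 0 = ∅ := by
        ext ω
        simp only [hE, Set.mem_ofPred_eq, Set.mem_empty_iff_false, iff_false]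
        rintro ⟨t, h1, h2, -⟩
        omega
      simp [this]
    | succ n ih =>
      refine (hstep (n + 1)).trans (le_trans ?_ ih)
      exact add_le_add_right (hsuper (n + 1) (by omega) _ (hEm (n + 1)).compl) _
  have hU : {ω | ∃ t, 1 ≤ t ∧ c ≤ M t ω} = ⋃ n, E (n + 1) := by
    ext ω
    simp only [hE, Set.mem_ofPred_eq, Set.mem_iUnion]
    constructor
    · rintro ⟨t, h1, h2⟩
      exact ⟨t, t, h1, by omega, h2⟩
    · rintro ⟨n, t, h1, -, h2⟩
      exact ⟨t, h1, h2⟩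
  have hmono : Monotone fun n => E (n + 1) := by
    rintro a b hab ω ⟨t, h1, h2, h3⟩
    exact ⟨t, h1, by omega, h3⟩
  rw [hU, hmono.measure_iUnion, ENNReal.mul_iSup]
  exact iSup_le fun n => le_self_add.trans (key n)

/-! ### One-step conditional exponential bound -/

theorem integral_mul_condExp_eq {Ω : Type*} {m mΩ : MeasurableSpace Ω} {P : Measure Ω}
    [IsFiniteMeasure P] (hm : m ≤ mΩ) {f g : Ω → ℝ} (hg : StronglyMeasurable[m] g)
    (hgf : Integrable (g * f) P) (hf : Integrable f P) :
    ∫ ω, g ω * f ω ∂P = ∫ ω, g ω * P[f|m] ω ∂P := by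
  have h := condExp_mul_of_stronglyMeasurable_left hg hgf hf
  exact (integral_condExp hm).symm.trans (integral_congr_ae h)

/-- One step of the exponential supermartingale attached to a bounded martingale difference. -/
theorem setLIntegral_mul_exp_le {Ω : Type*} {m mΩ : MeasurableSpace Ω} {P : Measure Ω}
    [IsFiniteMeasure P] (hm : m ≤ mΩ) {W u e : Ω → ℝ} (hW : Measurable[m] W)
    (hW0 : ∀ ω, 0 ≤ W ω) {C : ℝ} (hWC : ∀ᵐ ω ∂P, W ω ≤ C) (hu : Measurable[m] u)
    (hu1 : ∀ ω, |u ω| ≤ 1) (he : Integrable e P) (he1 : ∀ᵐ ω ∂P, |e ω| ≤ 1)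
    (hec : P[e|m] =ᵐ[P] 0) {A : Set Ω} (hA : MeasurableSet[m] A) :
    ∫⁻ ω in A, ENNReal.ofReal
        (W ω * Real.exp (e ω * u ω - P[fun ω => e ω ^ 2|m] ω * u ω ^ 2)) ∂P
      ≤ ∫⁻ ω in A, ENNReal.ofReal (W ω) ∂P := by
  set v : Ω → ℝ := P[fun ω => e ω ^ 2|m] with hv
  have hvm : Measurable[m] v := stronglyMeasurable_condExp.measurable
  have hv0 : ∀ᵐ ω ∂P, 0 ≤ v ω := condExp_nonneg (ae_of_all _ fun ω => sq_nonneg _)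
  have hvi : Integrable v P := integrable_condExp
  have he2 : Integrable (fun ω => e ω ^ 2) P := by
    refine Integrable.of_bound (he.aestronglyMeasurable.pow 2) 1 ?_
    filter_upwards [he1] with ω h
    rw [Real.norm_eq_abs, abs_pow]
    exact pow_le_one₀ (abs_nonneg _) h
  -- Everything known at the present time is gathered in one bounded `m`-measurable weight, so that
  -- only `exp (e u)` remains to be averaged.
  set V : Ω → ℝ := A.indicator fun ω => W ω * Real.exp (-(v ω * u ω ^ 2)) with hV
  have hVm : Measurable[m] V :=
    (hW.mul (Real.measurable_exp.comp (hvm.mul (hu.pow_const 2)).neg)).indicator hA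
  have hV0 (ω : Ω) : 0 ≤ V ω :=
    Set.indicator_nonneg (fun ω _ => mul_nonneg (hW0 ω) (Real.exp_pos _).le) ω
  have hVC : ∀ᵐ ω ∂P, ‖V ω‖ ≤ C := by
    filter_upwards [hWC, hv0] with ω h1 h2
    rw [Real.norm_of_nonneg (hV0 ω)]
    by_cases hω : ω ∈ A
    · rw [hV, Set.indicator_of_mem hω]
      have : Real.exp (-(v ω * u ω ^ 2)) ≤ 1 := by
        rw [Real.exp_le_one_iff, neg_nonpos]; positivity
      nlinarith [hW0 ω]
    · rw [hV, Set.indicator_of_notMem hω]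
      exact (hW0 ω).trans h1
  have hu2 (ω : Ω) : u ω ^ 2 ≤ 1 := (sq_le_one_iff_abs_le_one _).2 (hu1 ω)
  have hVi : Integrable V P := Integrable.of_bound (hVm.mono hm le_rfl).aestronglyMeasurable C hVC
  have hVum : Measurable[m] fun ω => V ω * u ω := hVm.mul hu
  have hVu2m : Measurable[m] fun ω => V ω * u ω ^ 2 := hVm.mul (hu.pow_const 2)
  have hVuC : ∀ᵐ ω ∂P, ‖V ω * u ω‖ ≤ C := by
    filter_upwards [hVC] with ω h
    rw [norm_mul]
    exact (mul_le_of_le_one_right (norm_nonneg _) (hu1 ω)).trans h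
  have hVu2C : ∀ᵐ ω ∂P, ‖V ω * u ω ^ 2‖ ≤ C := by
    filter_upwards [hVC] with ω h
    rw [norm_mul, norm_pow]
    refine (mul_le_of_le_one_right (norm_nonneg _) ?_).trans h
    rw [Real.norm_eq_abs, sq_abs]
    exact hu2 ω
  have hVue : Integrable (fun ω => V ω * u ω * e ω) P :=
    he.bdd_mul (hVum.mono hm le_rfl).aestronglyMeasurable hVuC
  have hVue2 : Integrable (fun ω => V ω * u ω ^ 2 * e ω ^ 2) P :=
    he2.bdd_mul (hVu2m.mono hm le_rfl).aestronglyMeasurable hVu2C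
  have hVuv : Integrable (fun ω => V ω * u ω ^ 2 * v ω) P :=
    hvi.bdd_mul (hVu2m.mono hm le_rfl).aestronglyMeasurable hVu2C
  have I1 : ∫ ω, V ω * u ω * e ω ∂P = 0 := by
    rw [integral_mul_condExp_eq (f := e) hm hVum.stronglyMeasurable hVue he]
    refine integral_eq_zero_of_ae ?_
    filter_upwards [hec] with ω h
    simp [h]
  have I2 : ∫ ω, V ω * u ω ^ 2 * e ω ^ 2 ∂P = ∫ ω, V ω * u ω ^ 2 * v ω ∂P :=
    integral_mul_condExp_eq (f := fun ω => e ω ^ 2) hm hVu2m.stronglyMeasurable hVue2 he2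
  have I3 : ∫⁻ ω, ENNReal.ofReal (V ω + V ω * u ω * e ω + V ω * u ω ^ 2 * e ω ^ 2) ∂P
      = ∫⁻ ω, ENNReal.ofReal (V ω + V ω * u ω ^ 2 * v ω) ∂P := by
    have i1 : Integrable (fun ω => V ω + V ω * u ω * e ω + V ω * u ω ^ 2 * e ω ^ 2) P :=
      (hVi.add hVue).add hVue2
    have i2 : Integrable (fun ω => V ω + V ω * u ω ^ 2 * v ω) P := hVi.add hVuv
    rw [← ofReal_integral_eq_lintegral_ofReal i1, ← ofReal_integral_eq_lintegral_ofReal i2]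
    · congr 1
      have h1 := integral_add (hVi.add hVue) hVue2
      have h2 := integral_add hVi hVue
      have h3 := integral_add hVi hVuv
      simp only [Pi.add_apply] at h1 h2 h3 ⊢
      rw [h1, h2, h3, I1, I2, add_zero]
    · filter_upwards [hv0] with ω h
      have := hV0 ω
      rw [Pi.zero_apply]; positivity
    · refine ae_of_all _ fun ω => ?_
      have h1 := hV0 ω
      have h2 : 0 ≤ 1 + u ω * e ω + (u ω * e ω) ^ 2 := by nlinarith [sq_nonneg (u ω * e ω + 1)]
      have := mul_nonneg h1 h2
      rw [Pi.zero_apply]; nlinarith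
  have hAm : MeasurableSet A := hm _ hA
  rw [← lintegral_indicator hAm, ← lintegral_indicator hAm]
  calc _ ≤ ∫⁻ ω, ENNReal.ofReal (V ω + V ω * u ω * e ω + V ω * u ω ^ 2 * e ω ^ 2) ∂P := by
        refine lintegral_mono_ae ?_
        filter_upwards [he1] with ω h
        by_cases hω : ω ∈ A
        · rw [Set.indicator_of_mem hω]
          apply ENNReal.ofReal_le_ofReal
          have h1 : |e ω * u ω| ≤ 1 := by
            rw [abs_mul]; exact mul_le_one₀ h (abs_nonneg _) (hu1 ω)
          have h2 := (abs_le.1 (Real.abs_exp_sub_one_sub_id_le h1)).2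
          have h3 : W ω * Real.exp (e ω * u ω - v ω * u ω ^ 2) = V ω * Real.exp (e ω * u ω) := by
            rw [hV, Set.indicator_of_mem hω, sub_eq_add_neg, Real.exp_add]; ring
          rw [h3]
          have := mul_le_mul_of_nonneg_left h2 (hV0 ω)
          nlinarith
        · rw [Set.indicator_of_notMem hω]; exact zero_le
    _ = _ := I3
    _ ≤ _ := by
        refine lintegral_mono fun ω => ?_
        by_cases hω : ω ∈ A
        · simp only [hV, Set.indicator_of_mem hω]
          apply ENNReal.ofReal_le_ofReal
          have h1 := Real.add_one_le_exp (v ω * u ω ^ 2)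
          have h2 : 0 ≤ W ω * Real.exp (-(v ω * u ω ^ 2)) :=
            mul_nonneg (hW0 ω) (Real.exp_pos _).le
          have h3 : W ω * Real.exp (-(v ω * u ω ^ 2)) * Real.exp (v ω * u ω ^ 2) = W ω := by
            rw [mul_assoc, ← Real.exp_add]; simp
          nlinarith [mul_le_mul_of_nonneg_left h1 h2]
        · simp [hV, Set.indicator_of_notMem hω]

/-! ### The supermartingale in a fixed direction -/

section ExponentialWeights

variable {Ω : Type*} {mΩ : MeasurableSpace Ω} {P : Measure Ω} {d : ℕ} {ℱ : Filtration ℕ mΩ}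
  {x : ℕ → Ω → EuclideanSpace ℝ (Fin d)} {ε : ℕ → Ω → ℝ} {l : ℝ}

/-- The exponential weight `exp (⟨v, S⟩ - ‖v‖²_H)`. -/
noncomputable def expWeight (H : Matrix (Fin d) (Fin d) ℝ) (S v : EuclideanSpace ℝ (Fin d)) : ℝ :=
  Real.exp (v.ofLp ⬝ᵥ S.ofLp - v.ofLp ⬝ᵥ H.mulVec v.ofLp)

theorem measurable_expWeight_prod {Ω : Type*} {m : MeasurableSpace Ω}
    {H : Ω → Matrix (Fin d) (Fin d) ℝ} {S : Ω → EuclideanSpace ℝ (Fin d)}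
    (hH : ∀ i j, Measurable fun ω => H ω i j) (hS : Measurable S) :
    Measurable fun p : Ω × EuclideanSpace ℝ (Fin d) => expWeight (H p.1) (S p.1) p.2 := by
  have hc (i : Fin d) : Measurable fun p : Ω × EuclideanSpace ℝ (Fin d) => p.2.ofLp i := by
    fun_prop
  have hSc (i : Fin d) : Measurable fun p : Ω × EuclideanSpace ℝ (Fin d) => (S p.1).ofLp i := by
    fun_prop
  have hHc (i j : Fin d) : Measurable fun p : Ω × EuclideanSpace ℝ (Fin d) => H p.1 i j :=
    (hH i j).comp measurable_fst
  simp only [expWeight, dotProduct, Matrix.mulVec]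
  fun_prop

theorem measurable_lintegral_expWeight {Ω : Type*} {m : MeasurableSpace Ω}
    {H : Ω → Matrix (Fin d) (Fin d) ℝ} {S : Ω → EuclideanSpace ℝ (Fin d)}
    (hH : ∀ i j, Measurable fun ω => H ω i j) (hS : Measurable S)
    (ν : Measure (EuclideanSpace ℝ (Fin d))) [SFinite ν] :
    Measurable fun ω => ∫⁻ v, ENNReal.ofReal (expWeight (H ω) (S ω) v) ∂ν :=
  (measurable_expWeight_prod hH hS).ennreal_ofReal.lintegral_prod_right'

theorem measurable_martingaleSum (hx_meas : ∀ t, 1 ≤ t → Measurable[ℱ t] (x t))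
    (hε : IsMartingaleDifference ℱ P ε) (t : ℕ) : Measurable[ℱ t] (martingaleSum x ε t) := by
  unfold martingaleSum
  refine Finset.measurable_sum _ fun s hs => ?_
  rw [Finset.mem_Ico] at hs
  exact ((hε.measurable s hs.1).mono (ℱ.mono (by omega)) le_rfl).smul
    ((hx_meas s hs.1).mono (ℱ.mono (by omega)) le_rfl)

theorem measurable_regularizedVariation_apply (hx_meas : ∀ t, 1 ≤ t → Measurable[ℱ t] (x t))
    (t : ℕ) (i j : Fin d) :
    Measurable[ℱ t] fun ω => regularizedVariation ℱ P x ε l t ω i j := by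
  simp only [regularizedVariation, Matrix.add_apply, Matrix.sum_apply, Matrix.smul_apply,
    Matrix.vecMulVec_apply, smul_eq_mul]
  refine Measurable.add_const (Finset.measurable_sum _ fun s hs => ?_) _
  rw [Finset.mem_Ico] at hs
  have h1 : Measurable[ℱ s] (sigmaSq ℱ P ε s) := stronglyMeasurable_condExp.measurable
  have h2 (k : Fin d) : Measurable[ℱ s] fun ω => (x s ω).ofLp k :=
    (by fun_prop : Measurable fun y : EuclideanSpace ℝ (Fin d) => y.ofLp k).comp
      (hx_meas s hs.1)
  exact (h1.mul ((h2 i).mul (h2 j))).mono (ℱ.mono (by omega)) le_rfl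

theorem martingaleSum_succ {t : ℕ} (ht : 1 ≤ t) (ω : Ω) :
    martingaleSum x ε (t + 1) ω = martingaleSum x ε t ω + ε (t + 1) ω • x t ω := by
  rw [martingaleSum, martingaleSum, Finset.sum_Ico_succ_top ht]

theorem regularizedVariation_succ {t : ℕ} (ht : 1 ≤ t) (ω : Ω) :
    regularizedVariation ℱ P x ε l (t + 1) ω = regularizedVariation ℱ P x ε l t ω
      + sigmaSq ℱ P ε t ω • Matrix.vecMulVec (x t ω).ofLp (x t ω).ofLp := by
  rw [regularizedVariation, regularizedVariation, Finset.sum_Ico_succ_top ht]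
  abel

theorem expWeight_succ {t : ℕ} (ht : 1 ≤ t) (ω : Ω) (v : EuclideanSpace ℝ (Fin d)) :
    expWeight (regularizedVariation ℱ P x ε l (t + 1) ω) (martingaleSum x ε (t + 1) ω) v =
      expWeight (regularizedVariation ℱ P x ε l t ω) (martingaleSum x ε t ω) v *
        Real.exp (ε (t + 1) ω * (v.ofLp ⬝ᵥ (x t ω).ofLp)
          - sigmaSq ℱ P ε t ω * (v.ofLp ⬝ᵥ (x t ω).ofLp) ^ 2) := by
  rw [martingaleSum_succ ht, regularizedVariation_succ ht, expWeight, expWeight, ← Real.exp_add,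
    Matrix.add_mulVec, Matrix.smul_mulVec, Matrix.vecMulVec_mulVec, WithLp.ofLp_add,
    WithLp.ofLp_smul]
  congr 1
  simp only [dotProduct_add, dotProduct_smul, smul_eq_mul, op_smul_eq_smul,
    dotProduct_comm (x t ω).ofLp v.ofLp]
  ring

theorem regularizedVariation_one (ω : Ω) : regularizedVariation ℱ P x ε l 1 ω = l • 1 := by
  simp [regularizedVariation]

theorem martingaleSum_one (ω : Ω) : martingaleSum x ε 1 ω = 0 := by
  simp [martingaleSum]

theorem ae_sigmaSq_nonneg (t : ℕ) : ∀ᵐ ω ∂P, 0 ≤ sigmaSq ℱ P ε t ω :=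
  condExp_nonneg (ae_of_all _ fun _ => sq_nonneg _)

theorem ae_posSemidef_regularizedVariation_sub :
    ∀ᵐ ω ∂P, ∀ t, (regularizedVariation ℱ P x ε l t ω
      - l • (1 : Matrix (Fin d) (Fin d) ℝ)).PosSemidef := by
  filter_upwards [ae_all_iff.2 fun t => ae_sigmaSq_nonneg (ℱ := ℱ) (P := P) (ε := ε) t] with ω h t
  rw [regularizedVariation, add_sub_cancel_right]
  refine Matrix.posSemidef_sum _ fun s _ => ?_
  have := Matrix.posSemidef_vecMulVec_self_star (x s ω).ofLp
  rw [star_trivial] at this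
  exact this.smul (h s)

theorem EuclideanSpace.abs_dotProduct_le (u v : EuclideanSpace ℝ (Fin d)) :
    |u.ofLp ⬝ᵥ v.ofLp| ≤ ‖u‖ * ‖v‖ := by
  have := abs_real_inner_le_norm v u
  rwa [EuclideanSpace.inner_eq_star_dotProduct, star_trivial, mul_comm] at this

theorem ae_norm_martingaleSum_le (hx_ball : ∀ t, 1 ≤ t → ∀ ω, ‖x t ω‖ ≤ 1)
    (hε_bdd : ∀ t, 1 ≤ t → ∀ᵐ ω ∂P, |ε (t + 1) ω| ≤ 1) (t : ℕ) :
    ∀ᵐ ω ∂P, ‖martingaleSum x ε t ω‖ ≤ t := by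
  have h : ∀ᵐ ω ∂P, ∀ s, 1 ≤ s → |ε (s + 1) ω| ≤ 1 :=
    ae_all_iff.2 fun s => by
      by_cases hs : 1 ≤ s
      · filter_upwards [hε_bdd s hs] with ω h _ using h
      · exact ae_of_all _ fun ω h => absurd h hs
  filter_upwards [h] with ω h
  calc ‖martingaleSum x ε t ω‖ ≤ ∑ s ∈ Finset.Ico 1 t, (1 : ℝ) := by
        refine norm_sum_le_of_le _ fun s hs => ?_
        rw [Finset.mem_Ico] at hs
        rw [norm_smul]
        exact mul_le_one₀ (h s hs.1) (norm_nonneg _) (hx_ball s hs.1 ω)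
    _ ≤ t := by simp

/-- The exponential weights in a fixed direction of the unit ball form a supermartingale. -/
theorem setLIntegral_expWeight_succ_le [IsFiniteMeasure P] (hl : 0 < l)
    (hx_meas : ∀ t, 1 ≤ t → Measurable[ℱ t] (x t)) (hx_ball : ∀ t, 1 ≤ t → ∀ ω, ‖x t ω‖ ≤ 1)
    (hε : IsMartingaleDifference ℱ P ε) (hε_bdd : ∀ t, 1 ≤ t → ∀ᵐ ω ∂P, |ε (t + 1) ω| ≤ 1)
    {v : EuclideanSpace ℝ (Fin d)} (hv : ‖v‖ ≤ 1) {t : ℕ} (ht : 1 ≤ t) {A : Set Ω}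
    (hA : MeasurableSet[ℱ t] A) :
    ∫⁻ ω in A, ENNReal.ofReal (expWeight (regularizedVariation ℱ P x ε l (t + 1) ω)
        (martingaleSum x ε (t + 1) ω) v) ∂P ≤
      ∫⁻ ω in A, ENNReal.ofReal (expWeight (regularizedVariation ℱ P x ε l t ω)
        (martingaleSum x ε t ω) v) ∂P := by
  simp only [expWeight_succ ht]
  have hW : Measurable[ℱ t] fun ω =>
      expWeight (regularizedVariation ℱ P x ε l t ω) (martingaleSum x ε t ω) v :=
    (measurable_expWeight_prod (measurable_regularizedVariation_apply hx_meas t)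
      (measurable_martingaleSum hx_meas hε t)).comp measurable_prodMk_right
  have hu : Measurable[ℱ t] fun ω => v.ofLp ⬝ᵥ (x t ω).ofLp :=
    (by fun_prop : Measurable fun y : EuclideanSpace ℝ (Fin d) => v.ofLp ⬝ᵥ y.ofLp).comp
      (hx_meas t ht)
  refine setLIntegral_mul_exp_le (ℱ.le t) hW (fun ω => (Real.exp_pos _).le)
    -- The quadratic term only lowers the exponent, and `⟨v, S_t⟩ ≤ ‖S_t‖ ≤ t`.
    (C := Real.exp t) ?_ hu (fun ω => ?_) (hε.integrable t ht) (hε_bdd t ht)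
    (hε.condExp_eq_zero t ht) hA
  · filter_upwards [ae_posSemidef_regularizedVariation_sub (ℱ := ℱ) (P := P) (x := x) (ε := ε)
      (l := l), ae_norm_martingaleSum_le hx_ball hε_bdd t] with ω h1 h2
    refine Real.exp_le_exp.2 ?_
    have h3 := (h1 t).mul_sq_norm_le v
    have h4 : 0 ≤ l * ‖v‖ ^ 2 := by positivity
    have h5 := (le_abs_self _).trans (EuclideanSpace.abs_dotProduct_le v (martingaleSum x ε t ω))
    have h6 : ‖v‖ * ‖martingaleSum x ε t ω‖ ≤ 1 * t :=
      mul_le_mul hv h2 (norm_nonneg _) zero_le_one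
    linarith
  · exact (EuclideanSpace.abs_dotProduct_le v (x t ω)).trans
      (mul_le_one₀ hv (norm_nonneg _) (hx_ball t ht ω))

end ExponentialWeights

/-! ### Threshold and conclusion -/

/-- The deviation threshold turns the mixture bound into a level `1 / δ`. -/
theorem inv_le_exp_mul_of_threshold_le {d : ℕ} {l δ D w : ℝ} (hl : 0 < l) (hδ : 0 < δ)
    (hD : 0 < D)
    (h : √l / 2 + 2 / √l * Real.log (D ^ (1 / 2 : ℝ) * l ^ (-(d : ℝ) / 2) / δ)
      + 2 / √l * d * Real.log 2 ≤ w) :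
    δ⁻¹ ≤ Real.exp (√l / 2 * w - l / 4) *
      ((1 / 2) ^ d * (l ^ ((d : ℝ) / 2) * D ^ (-(1 / 2) : ℝ))) := by
  set a := D ^ (1 / 2 : ℝ) * l ^ (-(d : ℝ) / 2) / δ with ha
  have hDp : 0 < D ^ (1 / 2 : ℝ) := Real.rpow_pos_of_pos hD _
  have hlp : 0 < l ^ ((d : ℝ) / 2) := Real.rpow_pos_of_pos hl _
  have ha' : a = D ^ (1 / 2 : ℝ) * (l ^ ((d : ℝ) / 2))⁻¹ / δ := by
    rw [ha, neg_div, Real.rpow_neg hl.le]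
  have hapos : 0 < a := by rw [ha']; positivity
  have hs : 0 < √l := Real.sqrt_pos.2 hl
  have hss : √l * √l = l := Real.mul_self_sqrt hl.le
  have h1 : Real.log a + d * Real.log 2 ≤ √l / 2 * w - l / 4 := by
    have h2 := mul_le_mul_of_nonneg_left h (by positivity : 0 ≤ √l / 2)
    have h3 : √l / 2 * (√l / 2 + 2 / √l * Real.log a + 2 / √l * d * Real.log 2)
        = l / 4 + Real.log a + d * Real.log 2 := by
      rw [show l / 4 = √l * √l / 4 by rw [hss]]; field_simp; ring
    linarith
  have h4 : a * 2 ^ d ≤ Real.exp (√l / 2 * w - l / 4) := by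
    rw [← Real.log_le_iff_le_exp (by positivity), Real.log_mul hapos.ne' (by positivity),
      Real.log_pow]
    exact h1
  calc δ⁻¹ = a * 2 ^ d * ((1 / 2) ^ d * (l ^ ((d : ℝ) / 2) * D ^ (-(1 / 2) : ℝ))) := by
        rw [ha', Real.rpow_neg hD.le, one_div, inv_pow]
        field_simp
    _ ≤ _ := by
        refine mul_le_mul_of_nonneg_right h4 ?_
        have := Real.rpow_pos_of_pos hD (-(1 / 2))
        positivity

theorem theorem1 {Ω : Type*} {mΩ : MeasurableSpace Ω} (P : Measure Ω) [IsProbabilityMeasure P]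
    (d : ℕ) (ℱ : Filtration ℕ mΩ)
    (x : ℕ → Ω → EuclideanSpace ℝ (Fin d))
    (hx_meas : ∀ t, 1 ≤ t → Measurable[ℱ t] (x t))
    (hx_ball : ∀ t, 1 ≤ t → ∀ ω, x t ω ∈ Metric.closedBall (0 : EuclideanSpace ℝ (Fin d)) 1)
    (ε : ℕ → Ω → ℝ)
    (hε : IsMartingaleDifference ℱ P ε)
    (hε_bdd : ∀ t, 1 ≤ t → ∀ᵐ ω ∂P, |ε (t + 1) ω| ≤ 1)
    (l : ℝ) (hl : 0 < l) (δ : ℝ) (hδ : δ ∈ Set.Ioc (0 : ℝ) 1) :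
    P {ω | ∃ t : ℕ, 1 ≤ t ∧
        √l / 2
          + 2 / √l * Real.log
              ((regularizedVariation ℱ P x ε l t ω).det ^ (1 / 2 : ℝ) * l ^ (-(d : ℝ) / 2) / δ)
          + 2 / √l * d * Real.log 2
        ≤ weightedNorm (regularizedVariation ℱ P x ε l t ω)⁻¹ (martingaleSum x ε t ω)}
      ≤ ENNReal.ofReal δ := by
  have hx_norm : ∀ t, 1 ≤ t → ∀ ω, ‖x t ω‖ ≤ 1 := fun t ht ω =>
    mem_closedBall_zero_iff.1 (hx_ball t ht ω)
  set B := Metric.closedBall (0 : EuclideanSpace ℝ (Fin d)) 1 with hB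
  set H := fun t ω => regularizedVariation ℱ P x ε l t ω with hH
  set M : ℕ → Ω → ℝ≥0∞ := fun t ω =>
    ∫⁻ v in B, ENNReal.ofReal (expWeight (H t ω) (martingaleSum x ε t ω) v) with hM
  set N : ℝ≥0∞ := ∫⁻ v in B, ENNReal.ofReal (Real.exp (-(l * ‖v‖ ^ 2))) with hN
  have hN0 : N ≠ 0 := by
    have hm : Measurable fun v : EuclideanSpace ℝ (Fin d) =>
        ENNReal.ofReal (Real.exp (-(l * ‖v‖ ^ 2))) := by fun_prop
    refine (setLIntegral_pos_iff hm).2 ?_ |>.ne'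
    have : Function.support (fun v : EuclideanSpace ℝ (Fin d) =>
        ENNReal.ofReal (Real.exp (-(l * ‖v‖ ^ 2)))) = Set.univ := by
      ext v; simp [Real.exp_pos]
    rw [this, Set.univ_inter]
    exact Metric.measure_closedBall_pos volume _ one_pos
  have hNtop : N ≠ ∞ := by
    refine ne_top_of_le_ne_top (b := ∫⁻ v in B, (1 : ℝ≥0∞)) ?_ (lintegral_mono fun v => ?_)
    · simpa using measure_closedBall_lt_top.ne
    · rw [← ENNReal.ofReal_one]
      apply ENNReal.ofReal_le_ofReal
      rw [Real.exp_le_one_iff, neg_nonpos]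
      positivity
  have hM1 : ∫⁻ ω, M 1 ω ∂P = N := by
    have : M 1 = fun _ => N := by
      funext ω
      simp only [hM, hH, hN, expWeight, martingaleSum_one, regularizedVariation_one]
      simp [Matrix.smul_mulVec, EuclideanSpace.dotProduct_ofLp_self]
    simp [this]
  have hville := mul_measure_exists_le_le_lintegral (P := P) (ℱ := ℱ) (M := M)
    (fun t _ => measurable_lintegral_expWeight (measurable_regularizedVariation_apply hx_meas t)
      (measurable_martingaleSum hx_meas hε t) _)
    (fun t ht A hA => by
      have hmeas (s : ℕ) : AEMeasurable (Function.uncurry fun ω v =>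
          ENNReal.ofReal (expWeight (H s ω) (martingaleSum x ε s ω) v))
          ((P.restrict A).prod (volume.restrict B)) :=
        (measurable_expWeight_prod
          (fun i j => (measurable_regularizedVariation_apply hx_meas s i j).mono (ℱ.le s) le_rfl)
          ((measurable_martingaleSum hx_meas hε s).mono (ℱ.le s) le_rfl)).ennreal_ofReal.aemeasurable
      simp only [hM]
      rw [lintegral_lintegral_swap (hmeas _), lintegral_lintegral_swap (hmeas _)]
      refine setLIntegral_mono' Metric.isClosed_closedBall.measurableSet fun v hv => ?_
      exact setLIntegral_expWeight_succ_le hl hx_meas hx_norm hε hε_bdd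
        (mem_closedBall_zero_iff.1 hv) ht hA)
    (ENNReal.ofReal δ⁻¹ * N)
  rw [hM1] at hville
  have hbound : P {ω | ∃ t, 1 ≤ t ∧ ENNReal.ofReal δ⁻¹ * N ≤ M t ω} ≤ ENNReal.ofReal δ := by
    rw [mul_right_comm, ENNReal.ofReal_inv_of_pos hδ.1] at hville
    have h1 := (ENNReal.mul_le_mul_iff_left hN0 hNtop).1 (hville.trans_eq (one_mul N).symm)
    rwa [ENNReal.inv_mul_le_iff (ENNReal.ofReal_pos.2 hδ.1).ne' ENNReal.ofReal_ne_top,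
      mul_one, ← ENNReal.ofReal_inv_of_pos hδ.1] at h1
  -- The inclusion of events holds only almost surely, because the conditional variances are
  -- nonnegative only off a null set.
  refine (measure_mono_ae ?_).trans hbound
  filter_upwards [ae_posSemidef_regularizedVariation_sub (ℱ := ℱ) (P := P) (x := x) (ε := ε)
      (l := l)] with ω hω
  rintro ⟨t, ht, h⟩
  refine ⟨t, ht, le_trans ?_
    (mul_lintegral_exp_neg_le_lintegral_exp_dotProduct_sub hl (hω t) (martingaleSum x ε t ω))⟩
  refine mul_le_mul_left (ENNReal.ofReal_le_ofReal ?_) _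
  exact inv_le_exp_mul_of_threshold_le hl hδ.1 ((hω t).posDef_of_sub_smul_one hl).det_pos h
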